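/- Let $F$ be a commutative field and let $n\ge 3$. For $h\in\{1,2\}$ let $\wp_{n,h}$ be the Plücker embedding, which maps an $h$-dimensional subspace of $\mathrm{PG}(n,F)$ with basis $v_0,\dots,v_h$ to the point $F(v_0\wedge\dots\wedge v_h)$ of the projective space on $\bigwedge^{h+1}F^{n+1}$, and let $\mathcal G_{n,1}$ be the image of $\wp_{n,1}$ (the Grassmann variety of lines), whose ambient space is $\mathrm{PG}(M,F)$ with $M=(n^2+n-2)/2$. A linear complex of planes is a set $K$ consisting of all planes of $\mathrm{PG}(n,F)$ whose image under $\wp_{n,2}$ lies in a fixed hyperplane of the ambient space. A line is singular for $K$ if all planes through it belong to $K$. The polar hyperplane of a non-singular line $\ell$ is the hyperplane $E$ such that a plane $X\supseteq\ell$ belongs to $K$ if and only if $X\subseteq E$. A line spread of a projective space is a set of lines such that each point is on exactly one of them. It is linear if its Plücker image is the intersection of the Grassmann variety of lines of that projective space with a subspace of the ambient space of this variety, and geometric if for any two distinct lines $\ell,m$ of the spread the lines of the spread contained in the solid $\ell\vee m$ form a line spread of $\ell\vee m$. Let $K$ be a linear complex of planes in $\mathrm{PG}(n,F)$ having no singular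 line. For each hyperplane $H$ of $\mathrm{PG}(n,F)$, let $\mathcal F_H$ be the set of all lines whose polar hyperplane is $H$. Then $\mathcal F_H$ is a linear line spread of $H$. More precisely, $$\mathcal F_H^{\wp_{n,1}}=R\cap\mathcal G_{n,1}$$ for some subspace $R$ of $\mathrm{PG}(M,F)$ of projective dimension $M-n$. Furthermore, in each of the following cases the line spread $\mathcal F_H$ is not geometric: (a) $F$ is quadratically closed (every element of $F$ is a square in $F$); (b) $F$ is finite. -/

import Mathlib

open Module Submodule
open scoped exteriorPower

/-! Projective geometry over a field `F` is written in vector space language: if `V` has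
dimension `n + 1`, then the projective space on `V` is `PG(n, F)`, its `d`-subspaces are the
vector subspaces of dimension `d + 1`, its points, lines and planes are the subspaces of vector
dimension `1`, `2` and `3`, and its hyperplanes are the coatoms of the subspace lattice. -/

section LinearComplexes

variable {F V : Type*} [Field F] [AddCommGroup V] [Module F V]

/-- `X` is a `d`-subspace (a subspace of projective dimension `d`). -/
def IsProjSubspace (d : ℕ) (X : Submodule F V) : Prop :=
  finrank F X = d + 1

/-- The image of `⋀ᵏ X` in `⋀ᵏ V`, for a subspace `X` of `V`. -/
noncomputable def extPow (k : ℕ) (X : Submodule F V) : Submodule F (⋀[F]^k V) :=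
  LinearMap.range (exteriorPower.map k X.subtype)

/-- The Plücker map on `h`-subspaces: `X ↦ ⋀ʰ⁺¹ X`. This is the point `F (v₀ ∧ ⋯ ∧ vₕ)` of
the projective space on `⋀ʰ⁺¹ V`, where `v₀, …, vₕ` is any basis of `X`; see `pluecker_eq_span`. -/
noncomputable def pluecker (h : ℕ) (X : Submodule F V) : Submodule F (⋀[F]^(h + 1) V) :=
  extPow (h + 1) X

theorem pluecker_eq_span (h : ℕ) (X : Submodule F V) (b : Basis (Fin (h + 1)) F X) :
    pluecker h X =
      span F {exteriorPower.ιMulti F (h + 1) (fun i => (b i : V))} := by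
  have : Module.Finite F X := Module.Finite.of_basis b
  have hfr : finrank F X = h + 1 := by simpa using finrank_eq_card_basis b
  have h1 : finrank F (⋀[F]^(h + 1) X) = 1 := by
    rw [exteriorPower.finrank_eq, hfr, Nat.choose_self]
  have h0 : exteriorPower.ιMulti F (h + 1) (fun i => b i) ≠ 0 := by
    intro h0
    have h2 := exteriorPower.alternatingMapLinearEquiv_apply_ιMulti b.det (fun i => b i)
    rw [h0, map_zero] at h2
    exact zero_ne_one (h2.trans b.det_self)
  have h3 : span F {exteriorPower.ιMulti F (h + 1) (fun i => b i)} = ⊤ :=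
    (finrank_eq_one_iff_of_nonzero _ h0).1 h1
  rw [pluecker, extPow, LinearMap.range_eq_map, ← h3, map_span, Set.image_singleton,
    exteriorPower.map_apply_ιMulti]
  rfl

/-- `K` is a linear complex of `h`-subspaces: the set of all `h`-subspaces whose Plücker point
lies in a fixed hyperplane of the ambient space of the Grassmann variety. -/
def IsLinearComplex (h : ℕ) (K : Set (Submodule F V)) : Prop :=
  ∃ A : Submodule F (⋀[F]^(h + 1) V), IsCoatom A ∧
    K = {X | IsProjSubspace h X ∧ pluecker h X ≤ A}

/-- The `(h - 1)`-subspace `U` is singular for `K`: all `h`-subspaces through `U` are in `K`. -/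
def IsSingular (h : ℕ) (K : Set (Submodule F V)) (U : Submodule F V) : Prop :=
  finrank F U = h ∧ ∀ X : Submodule F V, IsProjSubspace h X → U ≤ X → X ∈ K

/-- The hyperplane `E` is the polar hyperplane of the non-singular `(h - 1)`-subspace `U`: an
`h`-subspace through `U` is in `K` if and only if it is contained in `E`. -/
def IsPolarHyperplane (h : ℕ) (K : Set (Submodule F V)) (U E : Submodule F V) : Prop :=
  finrank F U = h ∧ ¬ IsSingular h K U ∧ IsCoatom E ∧
    ∀ X : Submodule F V, IsProjSubspace h X → U ≤ X → (X ∈ K ↔ X ≤ E)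

/-- For a set `K` of planes and a hyperplane `H`: the lines whose polar hyperplane is `H`. -/
def polarLines (K : Set (Submodule F V)) (H : Submodule F V) : Set (Submodule F V) :=
  {l | IsPolarHyperplane 2 K l H}

/-- The set of all lines contained in the subspace `W`. -/
def linesIn (W : Submodule F V) : Set (Submodule F V) :=
  {l | IsProjSubspace 1 l ∧ l ≤ W}

/-- `S` is a line spread of the projective space on `W`: a set of lines of `W` such that every
point of `W` is on exactly one line of `S`. -/
def IsLineSpread (W : Submodule F V) (S : Set (Submodule F V)) : Prop :=
  S ⊆ linesIn W ∧
    ∀ P : Submodule F V, IsProjSubspace 0 P → P ≤ W → ∃! l, l ∈ S ∧ P ≤ l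

/-- A geometric line spread of `W`: for any two distinct lines of `S`, the lines of `S` in their
join form a line spread of the join. -/
def IsGeometricSpread (W : Submodule F V) (S : Set (Submodule F V)) : Prop :=
  IsLineSpread W S ∧
    ∀ l ∈ S, ∀ m ∈ S, l ≠ m → IsLineSpread (l ⊔ m) {k | k ∈ S ∧ k ≤ l ⊔ m}

/-- The Grassmann variety of the lines of `W`; its ambient space is that on `extPow 2 W`. -/
def grassmannLines (W : Submodule F V) : Set (Submodule F (⋀[F]^2 V)) :=
  pluecker 1 '' linesIn W

/-- A linear line spread of `W`: its Plücker image is the intersection of the Grassmann variety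
of the lines of `W` with a subspace of the ambient space of that variety. -/
def IsLinearSpread (W : Submodule F V) (S : Set (Submodule F V)) : Prop :=
  IsLineSpread W S ∧
    ∃ R : Submodule F (⋀[F]^2 V), R ≤ extPow 2 W ∧
      pluecker 1 '' S = grassmannLines W ∩ {P | P ≤ R}

end LinearComplexes

/-- Every element has a square root. (In characteristic `2` this is implied by, and weaker than,
the requirement that every quadratic polynomial has a root; in all other characteristics the two
are equivalent.) -/
def IsQuadraticallyClosed (F : Type*) [Field F] : Prop :=
  ∀ x : F, IsSquare x

/-! ### Spanning pairs and triples for lines and planes. -/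

section Pairs

variable {F V : Type*} [Field F] [AddCommGroup V] [Module F V]

/-! Write K as the planes on which an alternating trilinear form f vanishes, and put g(u,v) =
f(·,u,v) ∈ V*. Absence of singular lines means g(u,v) ≠ 0 for independent u, v
(`IsComplexOf.pairing_ne_zero`), and the polar hyperplane of ⟨u,v⟩ is ker g(u,v).

For u ≠ 0 the map g(u,·) has kernel ⟨u⟩, so by dimension its image is the whole annihilator of u
(`IsComplexOf.range_pairing`). Hence if u ∈ H = ker θ, then g(u,v) = θ has a solution v, unique
modulo u: this is the spread property. Having polar hyperplane H is a linear condition on u∧v,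
namely membership in the kernel of a map ⋀²V → H*. That map is onto, which gives the dimension of R.

If the spread were geometric, take spread lines ⟨a,b⟩ and ⟨c,d⟩ with g(a,b) = g(c,d) = θ. The spread
lines through a+c and a+d stay in the solid and express g(b,c) and g(b,d) by g(a,c), g(a,d), θ. So g
kills a 3-dimensional space of bivectors of the solid, on which the Plücker relation is a ternary
quadratic form. Over the fields in (a) and (b) it has a nontrivial zero, that is, a line with g(u,v)
= 0: a contradiction (`exists_pairing_eq_zero`). -/

theorem finrank_span_pair {u v : V} (h : LinearIndependent F ![u, v]) :
    finrank F (span F {u, v}) = 2 := by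
  have := finrank_span_eq_card h
  rwa [Matrix.range_cons_cons_empty, Fintype.card_fin] at this

theorem linearIndependent_pair_of_notMem {u v : V} (hu : u ≠ 0) (hv : v ∉ span F {u}) :
    LinearIndependent F ![u, v] :=
  (LinearIndependent.pair_iff' hu).2 fun a ha => hv (mem_span_singleton.2 ⟨a, ha⟩)

theorem mem_span_singleton_of_not_linearIndependent {u v : V} (hu : u ≠ 0)
    (h : ¬ LinearIndependent F ![u, v]) : v ∈ span F {u} := by
  by_contra hv
  exact h (linearIndependent_pair_of_notMem hu hv)

/-- A line through the point spanned by `u` is spanned by `u` and any further vector on it. -/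
theorem eq_span_pair_of_mem {l : Submodule F V} (hl : finrank F l = 2) {u v : V}
    (h : LinearIndependent F ![u, v]) (hu : u ∈ l) (hv : v ∈ l) : l = span F {u, v} := by
  have : FiniteDimensional F l := .of_finrank_pos (by omega)
  refine (eq_of_le_of_finrank_eq (span_le.2 ?_) ?_).symm
  · rintro x (rfl | rfl) <;> assumption
  · rw [finrank_span_pair h, hl]

theorem exists_linearIndependent_pair_of_mem {l : Submodule F V} (hl : finrank F l = 2) {u : V}
    (hu : u ≠ 0) (hul : u ∈ l) :
    ∃ v, LinearIndependent F ![u, v] ∧ l = span F {u, v} := by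
  have hne : ¬ l ≤ span F {u} := by
    intro hle
    have h1 := Submodule.finrank_mono hle
    rw [finrank_span_singleton hu] at h1
    omega
  obtain ⟨v, hv, hvu⟩ := SetLike.not_le_iff_exists.1 hne
  have hi := linearIndependent_pair_of_notMem hu hvu
  exact ⟨v, hi, eq_span_pair_of_mem hl hi hul hv⟩

theorem exists_linearIndependent_pair {l : Submodule F V} (hl : finrank F l = 2) :
    ∃ u v, LinearIndependent F ![u, v] ∧ l = span F {u, v} := by
  have : l ≠ ⊥ := by
    rintro rfl
    simp at hl
  obtain ⟨u, hul, hu⟩ := exists_mem_ne_zero_of_ne_bot this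
  exact ⟨u, exists_linearIndependent_pair_of_mem hl hu hul⟩

theorem linearIndependent_triple {u v w : V} (h : LinearIndependent F ![u, v])
    (hw : w ∉ span F {u, v}) : LinearIndependent F ![w, u, v] := by
  refine linearIndependent_finCons.2 ⟨h, ?_⟩
  rwa [Matrix.range_cons_cons_empty]

theorem eq_span_triple {X : Submodule F V} (hX : finrank F X = 3) {u v w : V}
    (h : LinearIndependent F ![w, u, v]) (hle : span F {u, v} ≤ X) (hw : w ∈ X) :
    X = span F (Set.range ![w, u, v]) := by
  have : FiniteDimensional F X := .of_finrank_pos (by omega)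
  refine (eq_of_le_of_finrank_eq (span_le.2 ?_) ?_).symm
  · rintro _ ⟨i, rfl⟩
    fin_cases i
    · exact hw
    · exact hle (subset_span (by simp))
    · exact hle (subset_span (by simp))
  · rw [finrank_span_eq_card h, Fintype.card_fin, hX]

theorem pluecker_span_range {h : ℕ} {v : Fin (h + 1) → V} (hv : LinearIndependent F v) :
    pluecker h (span F (Set.range v)) = span F {exteriorPower.ιMulti F (h + 1) v} := by
  rw [pluecker_eq_span h _ (Basis.span hv)]
  congr 4
  ext i
  exact congrArg Subtype.val (Basis.span_apply hv i)

end Pairs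

/-! ### Contracting a trilinear form with a line. -/

section Contraction

variable {F V N : Type*} [Field F] [AddCommGroup V] [Module F V] [AddCommGroup N] [Module F N]

/-- The alternating bilinear map `(u, v) ↦ f (·, u, v)` with values in the dual space. -/
noncomputable def contraction (f : V [⋀^Fin 3]→ₗ[F] F) : V [⋀^Fin 2]→ₗ[F] Dual F V where
  toFun m :=
    { toFun := fun w => f.curryLeft w m
      map_add' := fun _ _ => by simp
      map_smul' := fun _ _ => by simp }
  map_update_add' m i x y := by
    ext w
    exact (f.curryLeft w).map_update_add m i x y
  map_update_smul' m i c x := by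
    ext w
    exact (f.curryLeft w).map_update_smul m i c x
  map_eq_zero_of_eq' m i j h hij := by
    ext w
    exact (f.curryLeft w).map_eq_zero_of_eq m h hij

/-- An alternating map in two variables as a bilinear map. -/
noncomputable def pairing (g : V [⋀^Fin 2]→ₗ[F] N) : V →ₗ[F] V →ₗ[F] N :=
  LinearMap.mk₂ F (fun u v => g ![u, v])
    (fun x y v => DFunLike.congr_fun (g.curryLeft.map_add x y) ![v])
    (fun c x v => DFunLike.congr_fun (g.curryLeft.map_smul c x) ![v])
    (fun u x y => DFunLike.congr_fun ((g.curryLeft u).curryLeft.map_add x y) ![])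
    (fun c u x => DFunLike.congr_fun ((g.curryLeft u).curryLeft.map_smul c x) ![])

theorem pairing_apply (g : V [⋀^Fin 2]→ₗ[F] N) (u v : V) : pairing g u v = g ![u, v] := rfl

theorem pairing_self (g : V [⋀^Fin 2]→ₗ[F] N) (u : V) : pairing g u u = 0 :=
  g.map_eq_zero_of_eq _ (i := 0) (j := 1) rfl (by decide)

theorem pairing_swap (g : V [⋀^Fin 2]→ₗ[F] N) (u v : V) : pairing g u v = - pairing g v u := by
  have h := pairing_self g (u + v)
  simp only [map_add, LinearMap.add_apply, pairing_self, zero_add, add_zero] at h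
  exact eq_neg_of_add_eq_zero_right h

theorem pairing_contraction_left (f : V [⋀^Fin 3]→ₗ[F] F) (u v : V) :
    pairing (contraction f) u v u = 0 :=
  f.map_eq_zero_of_eq ![u, u, v] (i := 0) (j := 1) rfl (by decide)

theorem pairing_contraction_right (f : V [⋀^Fin 3]→ₗ[F] F) (u v : V) :
    pairing (contraction f) u v v = 0 :=
  f.map_eq_zero_of_eq ![v, u, v] (i := 0) (j := 2) rfl (by decide)

theorem pairing_contraction_of_mem (f : V [⋀^Fin 3]→ₗ[F] F) {u v w : V}
    (hw : w ∈ span F {u, v}) : pairing (contraction f) u v w = 0 := by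
  obtain ⟨a, b, rfl⟩ := mem_span_pair.1 hw
  rw [map_add, map_smul, map_smul, pairing_contraction_left, pairing_contraction_right]
  simp

end Contraction

/-! ### Isotropic vectors of ternary quadratic forms. -/

section TernaryForms

variable {F : Type*} [Field F]

theorem exists_isotropic_of_isQuadraticallyClosed (hF : IsQuadraticallyClosed F)
    (a b c d e : F) : ∃ y z w : F, (y ≠ 0 ∨ z ≠ 0 ∨ w ≠ 0) ∧
      y ^ 2 + a * y * z + b * y * w + c * z ^ 2 + d * z * w + e * w ^ 2 = 0 := by
  by_cases h2 : (2 : F) = 0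
  -- In characteristic 2, choose (z, w) to cancel the part linear in y; what remains is y² plus a
  -- constant, so a square root suffices. The choice (b, a) works because 2ab = 0.
  · obtain ⟨z, w, hzw, h⟩ : ∃ z w : F, (z ≠ 0 ∨ w ≠ 0) ∧ a * z + b * w = 0 := by
      by_cases hab : a = 0 ∧ b = 0
      · exact ⟨1, 0, by simp, by simp [hab.1]⟩
      · refine ⟨b, a, by tauto, ?_⟩
        linear_combination a * b * h2
    obtain ⟨y, hy⟩ := hF (c * z ^ 2 + d * z * w + e * w ^ 2)
    exact ⟨y, z, w, .inr hzw, by linear_combination hy + y * h + y ^ 2 * h2⟩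
  · obtain ⟨s, hs⟩ := hF (discrim 1 a c)
    obtain ⟨y, hy⟩ : ∃ y : F, 1 * (y * y) + a * y + c = 0 := by
      have : NeZero (2 : F) := ⟨h2⟩
      exact exists_quadratic_eq_zero one_ne_zero ⟨s, hs⟩
    exact ⟨y, 1, 0, by simp, by linear_combination hy⟩

/-- Chevalley–Warning: the degree 2 is less than the number 3 of variables, so the characteristic
divides the number of zeros, and the trivial zero is not the only one. -/
theorem exists_isotropic_of_finite [Finite F]
    (a b c d e : F) : ∃ y z w : F, (y ≠ 0 ∨ z ≠ 0 ∨ w ≠ 0) ∧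
      y ^ 2 + a * y * z + b * y * w + c * z ^ 2 + d * z * w + e * w ^ 2 = 0 := by
  classical
  have := Fintype.ofFinite F
  obtain ⟨p, hp⟩ := CharP.exists F
  have hprime : p.Prime := (CharP.char_is_prime_or_zero F p).resolve_right
    (CharP.char_ne_zero_of_finite F p)
  open MvPolynomial in
  let P : MvPolynomial (Fin 3) F := X 0 ^ 2 + C a * X 0 * X 1 + C b * X 0 * X 2 +
    C c * X 1 ^ 2 + C d * X 1 * X 2 + C e * X 2 ^ 2
  have hdeg : P.totalDegree < Fintype.card (Fin 3) := by
    have hh : P.IsHomogeneous 2 := by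
      have hX (i : Fin 3) := MvPolynomial.isHomogeneous_X F i
      have hC (r : F) := MvPolynomial.isHomogeneous_C (Fin 3) r
      exact (((((((hX 0).pow 2).add (((hC a).mul (hX 0)).mul (hX 1))).add
        (((hC b).mul (hX 0)).mul (hX 2))).add ((hC c).mul ((hX 1).pow 2))).add
        (((hC d).mul (hX 1)).mul (hX 2))).add ((hC e).mul ((hX 2).pow 2)))
    have := hh.totalDegree_le
    simp only [Fintype.card_fin]
    omega
  have hdvd := char_dvd_card_solutions p hdeg
  have h0 : MvPolynomial.eval (0 : Fin 3 → F) P = 0 := by simp [P]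
  have hcard : 1 < Fintype.card {x // MvPolynomial.eval x P = 0} :=
    lt_of_lt_of_le hprime.one_lt (Nat.le_of_dvd (Fintype.card_pos_iff.2 ⟨⟨0, h0⟩⟩) hdvd)
  obtain ⟨⟨x, hx⟩, hne⟩ := Fintype.exists_ne_of_one_lt_card hcard ⟨0, h0⟩
  refine ⟨x 0, x 1, x 2, ?_, by simpa [P] using hx⟩
  by_contra! hcon
  refine hne (Subtype.ext (funext fun i => ?_))
  fin_cases i
  exacts [hcon.1, hcon.2.1, hcon.2.2]

end TernaryForms

/-! ### Polar hyperplanes and the spread property. -/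

section PolarLines

variable {F V : Type*} [Field F] [AddCommGroup V] [Module F V]

theorem exists_ker_eq_of_isCoatom {A : Submodule F V} (hA : IsCoatom A) :
    ∃ φ : Dual F V, φ ≠ 0 ∧ LinearMap.ker φ = A := by
  obtain ⟨φ, hφ, hle⟩ := exists_le_ker_of_lt_top A hA.lt_top
  refine ⟨φ, hφ, (hA.le_iff.1 hle).resolve_left fun h => hφ (LinearMap.ker_eq_top.1 h)⟩

/-- `K` consists of the planes on which the alternating form `f` vanishes: this is read off from any
line of the plane and a further vector of it. -/
def IsComplexOf (K : Set (Submodule F V)) (f : V [⋀^Fin 3]→ₗ[F] F) : Prop :=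
  ∀ (X : Submodule F V) (u v w : V), finrank F X = 3 → LinearIndependent F ![u, v] →
    span F {u, v} ≤ X → w ∈ X → w ∉ span F {u, v} →
    (X ∈ K ↔ pairing (contraction f) u v w = 0)

theorem IsLinearComplex.exists_alternatingMap {K : Set (Submodule F V)}
    (hK : IsLinearComplex 2 K) : ∃ f : V [⋀^Fin 3]→ₗ[F] F, IsComplexOf K f := by
  obtain ⟨A, hA, rfl⟩ := hK
  obtain ⟨φ, -, rfl⟩ := exists_ker_eq_of_isCoatom hA
  refine ⟨φ.compAlternatingMap (exteriorPower.ιMulti F 3), fun X u v w hX huv hle hw hwl => ?_⟩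
  have hi := linearIndependent_triple huv hwl
  have hp : pluecker 2 X ≤ LinearMap.ker φ ↔ φ (exteriorPower.ιMulti F 3 ![w, u, v]) = 0 := by
    rw [eq_span_triple hX hi hle hw, pluecker_span_range hi, span_singleton_le_iff_mem]
    rfl
  exact ⟨fun h => hp.1 h.2, fun h => ⟨hX, hp.2 h⟩⟩

theorem exists_mem_notMem_finrank_three {u v : V} (huv : LinearIndependent F ![u, v]) {w : V}
    (hw : w ∉ span F {u, v}) :
    ∃ X : Submodule F V, finrank F X = 3 ∧ span F {u, v} ≤ X ∧ w ∈ X ∧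
      ∀ Y : Submodule F V, u ∈ Y → v ∈ Y → w ∈ Y → X ≤ Y := by
  refine ⟨span F (Set.range ![w, u, v]), ?_, ?_, subset_span ⟨0, rfl⟩, ?_⟩
  · rw [finrank_span_eq_card (linearIndependent_triple huv hw), Fintype.card_fin]
  · refine span_mono ?_
    rintro x (rfl | rfl)
    exacts [⟨1, rfl⟩, ⟨2, rfl⟩]
  · rintro Y hu hv hw
    refine span_le.2 ?_
    rintro _ ⟨i, rfl⟩
    fin_cases i <;> assumption

variable {K : Set (Submodule F V)} {f : V [⋀^Fin 3]→ₗ[F] F}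

theorem exists_mem_notMem_span_pair {u v : V} {X : Submodule F V} (hX : 3 ≤ finrank F X) :
    ∃ w ∈ X, w ∉ span F {u, v} := by
  classical
  refine SetLike.not_le_iff_exists.1 fun hle => ?_
  have : FiniteDimensional F (span F ({u, v} : Set V)) :=
    FiniteDimensional.span_of_finite F (by simp)
  have h1 := Submodule.finrank_mono hle
  have h2 := finrank_span_le_card (R := F) ({u, v} : Set V)
  have h3 : ({u, v} : Set V).toFinset.card ≤ 2 := by
    simpa using Finset.card_le_two (a := u) (b := v)
  omega

theorem IsComplexOf.pairing_ne_zero (hK : IsComplexOf K f) (hsing : ∀ l, ¬ IsSingular 2 K l)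
    {u v : V} (huv : LinearIndependent F ![u, v]) : pairing (contraction f) u v ≠ 0 := by
  intro h0
  refine hsing (span F {u, v}) ⟨finrank_span_pair huv, fun X hX hle => ?_⟩
  obtain ⟨w, hw, hwl⟩ := exists_mem_notMem_span_pair (F := F) (u := u) (v := v) (X := X) hX.ge
  exact (hK X u v w hX huv hle hw hwl).2 (by simp [h0])

theorem finrank_isCoatom [FiniteDimensional F V] {H : Submodule F V} (hH : IsCoatom H) :
    finrank F H + 1 = finrank F V := by
  obtain ⟨φ, hφ, rfl⟩ := exists_ker_eq_of_isCoatom hH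
  exact Dual.finrank_ker_add_one_of_ne_zero hφ

/-- The functional on the right is nonzero, so its kernel is a hyperplane; if it contains the
maximal subspace H, it equals H. -/
theorem IsComplexOf.isPolarHyperplane_iff (hK : IsComplexOf K f)
    (hsing : ∀ l, ¬ IsSingular 2 K l) (hV : 4 ≤ finrank F V)
    {H : Submodule F V} (hH : IsCoatom H) {u v : V} (huv : LinearIndependent F ![u, v]) :
    IsPolarHyperplane 2 K (span F {u, v}) H ↔ ∀ w ∈ H, pairing (contraction f) u v w = 0 := by
  have : FiniteDimensional F V := .of_finrank_pos (by omega)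
  have hne := hK.pairing_ne_zero hsing huv
  constructor
  · rintro ⟨-, -, -, hX⟩ w hw
    have hker := Dual.finrank_ker_add_one_of_ne_zero hne
    -- The definition of a polar hyperplane does not say that it contains the line. Since the kernel
    -- has dimension at least 3, some plane of K passes through the line, and this plane lies in H.
    obtain ⟨x, hx, hxl⟩ := exists_mem_notMem_span_pair (F := F) (u := u) (v := v)
      (X := LinearMap.ker (pairing (contraction f) u v)) (by omega)
    obtain ⟨X, hX3, hlX, hxX, -⟩ := exists_mem_notMem_finrank_three huv hxl
    have hXH : X ≤ H := (hX X hX3 hlX).1 ((hK X u v x hX3 huv hlX hxX hxl).2 hx)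
    by_cases hwl : w ∈ span F {u, v}
    · exact pairing_contraction_of_mem f hwl
    obtain ⟨Y, hY3, hlY, hwY, hY⟩ := exists_mem_notMem_finrank_three huv hwl
    refine (hK Y u v w hY3 huv hlY hwY hwl).1 ((hX Y hY3 hlY).2 (hY H ?_ ?_ hw))
    · exact hXH (hlX (subset_span (by simp)))
    · exact hXH (hlX (subset_span (by simp)))
  · intro h
    have hker : LinearMap.ker (pairing (contraction f) u v) = H :=
      (hH.le_iff.1 fun w hw => h w hw).resolve_left fun h => hne (LinearMap.ker_eq_top.1 h)
    refine ⟨finrank_span_pair huv, hsing _, hH, fun X hX hle => ?_⟩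
    obtain ⟨w, hw, hwl⟩ := exists_mem_notMem_span_pair (F := F) (u := u) (v := v) (X := X) hX.ge
    rw [hK X u v w hX huv hle hw hwl]
    constructor
    · intro h0
      rw [eq_span_triple hX (linearIndependent_triple huv hwl) hle hw, span_le, ← hker]
      rintro _ ⟨i, rfl⟩
      fin_cases i
      exacts [h0, pairing_contraction_left f u v, pairing_contraction_right f u v]
    · exact fun hXH => h w (hXH hw)

/-- Two vectors that span a line with polar hyperplane `H` lie in `H`. -/
theorem IsComplexOf.mem_of_forall_pairing_eq_zero (hK : IsComplexOf K f)
    (hsing : ∀ l, ¬ IsSingular 2 K l) {H : Submodule F V} (hH : IsCoatom H) {u v : V}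
    (huv : LinearIndependent F ![u, v]) (h : ∀ w ∈ H, pairing (contraction f) u v w = 0) :
    span F {u, v} ≤ H := by
  have hker : LinearMap.ker (pairing (contraction f) u v) = H :=
    (hH.le_iff.1 fun w hw => h w hw).resolve_left fun h =>
      hK.pairing_ne_zero hsing huv (LinearMap.ker_eq_top.1 h)
  exact fun w hw => hker ▸ pairing_contraction_of_mem f hw

theorem IsComplexOf.ker_pairing (hK : IsComplexOf K f) (hsing : ∀ l, ¬ IsSingular 2 K l)
    {u : V} (hu : u ≠ 0) : LinearMap.ker (pairing (contraction f) u) = span F {u} := by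
  ext v
  refine ⟨fun hv => ?_, fun hv => ?_⟩
  · exact mem_span_singleton_of_not_linearIndependent hu fun h =>
      hK.pairing_ne_zero hsing h hv
  · obtain ⟨c, rfl⟩ := mem_span_singleton.1 hv
    simp [pairing_self]

/-- The inclusion holds because f is alternating; equality is rank–nullity with the one-dimensional
kernel ⟨u⟩. -/
theorem IsComplexOf.range_pairing [FiniteDimensional F V] (hK : IsComplexOf K f)
    (hsing : ∀ l, ¬ IsSingular 2 K l) {u : V} (hu : u ≠ 0) :
    LinearMap.range (pairing (contraction f) u) = (span F {u}).dualAnnihilator := by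
  apply eq_of_le_of_finrank_eq
  · rintro _ ⟨v, rfl⟩
    rw [mem_dualAnnihilator]
    intro w hw
    obtain ⟨c, rfl⟩ := mem_span_singleton.1 hw
    simp [pairing_contraction_left]
  · have h1 := LinearMap.finrank_range_add_finrank_ker (pairing (contraction f) u)
    have h2 := Subspace.finrank_add_finrank_dualAnnihilator_eq (span F {u})
    rw [hK.ker_pairing hsing hu] at h1
    omega

theorem IsComplexOf.exists_pairing_eq [FiniteDimensional F V] (hK : IsComplexOf K f)
    (hsing : ∀ l, ¬ IsSingular 2 K l) {u : V} (hu : u ≠ 0) {θ : Dual F V} (hθ : θ u = 0) :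
    ∃ v, pairing (contraction f) u v = θ := by
  have : θ ∈ LinearMap.range (pairing (contraction f) u) := by
    rw [hK.range_pairing hsing hu, mem_dualAnnihilator]
    intro w hw
    obtain ⟨c, rfl⟩ := mem_span_singleton.1 hw
    simp [hθ]
  exact this

/-- Functionals that vanish on the hyperplane `ker θ` are multiples of `θ`. -/
theorem exists_eq_smul_of_ker_le {θ η : Dual F V} (h : ∀ w, θ w = 0 → η w = 0) :
    ∃ c : F, η = c • θ := by
  by_cases hθ : θ = 0
  · exact ⟨0, by ext w; simpa using h w (by simp [hθ])⟩
  obtain ⟨e, he⟩ : ∃ e, θ e ≠ 0 := by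
    by_contra! hcon
    exact hθ (LinearMap.ext hcon)
  refine ⟨η e / θ e, LinearMap.ext fun w => ?_⟩
  have h1 := h (w - (θ w / θ e) • e) (by simp [he])
  simp only [map_sub, map_smul, smul_eq_mul, sub_eq_zero] at h1
  rw [h1, LinearMap.smul_apply, smul_eq_mul]
  ring

theorem IsComplexOf.isLineSpread_polarLines (hK : IsComplexOf K f)
    (hsing : ∀ l, ¬ IsSingular 2 K l) (hV : 4 ≤ finrank F V)
    {H : Submodule F V} (hH : IsCoatom H) : IsLineSpread H (polarLines K H) := by
  have : FiniteDimensional F V := .of_finrank_pos (by omega)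
  refine ⟨fun l hl => ?_, fun P hP hPH => ?_⟩
  · obtain ⟨u, v, huv, rfl⟩ := exists_linearIndependent_pair hl.1
    exact ⟨finrank_span_pair huv, hK.mem_of_forall_pairing_eq_zero hsing hH huv
      ((hK.isPolarHyperplane_iff hsing hV hH huv).1 hl)⟩
  · obtain ⟨u, hu, rfl⟩ : ∃ u, u ≠ 0 ∧ P = span F {u} := by
      have : P ≠ ⊥ := by
        rintro rfl
        simp [IsProjSubspace] at hP
      obtain ⟨u, huP, hu⟩ := exists_mem_ne_zero_of_ne_bot this
      refine ⟨u, hu, (eq_of_le_of_finrank_eq ?_ ?_).symm⟩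
      · rwa [span_singleton_le_iff_mem]
      · rw [finrank_span_singleton hu, hP]
    have huH : u ∈ H := by rwa [span_singleton_le_iff_mem] at hPH
    obtain ⟨θ, hθ, rfl⟩ := exists_ker_eq_of_isCoatom hH
    obtain ⟨v, hv⟩ := hK.exists_pairing_eq hsing hu (θ := θ) huH
    have huv : LinearIndependent F ![u, v] := by
      refine linearIndependent_pair_of_notMem hu fun h => hθ ?_
      rw [← hK.ker_pairing hsing hu] at h
      rw [← hv]
      exact h
    refine ⟨span F {u, v}, ⟨?_, ?_⟩, ?_⟩
    · refine (hK.isPolarHyperplane_iff hsing hV hH huv).2 fun w hw => ?_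
      rw [hv]
      exact hw
    · exact span_mono (by simp)
    · rintro l ⟨hl, hul⟩
      rw [span_singleton_le_iff_mem] at hul
      obtain ⟨x, hux, rfl⟩ := exists_linearIndependent_pair_of_mem hl.1 hu hul
      have hx := (hK.isPolarHyperplane_iff hsing hV hH hux).1 hl
      obtain ⟨c, hc⟩ := exists_eq_smul_of_ker_le (θ := θ) hx
      -- Uniqueness: x and c • v have the same image under g(u,·), so they differ by a multiple of
      -- u.
      have hmem : x - c • v ∈ span F {u} := by
        rw [← hK.ker_pairing hsing hu, LinearMap.mem_ker, map_sub, map_smul, hv, hc, sub_self]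
      obtain ⟨d, hd⟩ := mem_span_singleton.1 hmem
      refine (eq_span_pair_of_mem (finrank_span_pair huv) hux (subset_span (by simp)) ?_).symm
      exact mem_span_pair.2 ⟨d, c, by rw [hd]; abel⟩

end PolarLines

/-! ### Linearity of the spread and the dimension of R. -/

section Linear

variable {F V : Type*} [Field F] [AddCommGroup V] [Module F V]
variable {K : Set (Submodule F V)} {f : V [⋀^Fin 3]→ₗ[F] F}

/-- The linear map `⋀² V → H*` induced by an alternating trilinear form. -/
noncomputable def polarMap (f : V [⋀^Fin 3]→ₗ[F] F) (H : Submodule F V) :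
    ⋀[F]^2 V →ₗ[F] Dual F H :=
  H.subtype.dualMap ∘ₗ exteriorPower.alternatingMapLinearEquiv (contraction f)

theorem polarMap_ιMulti (f : V [⋀^Fin 3]→ₗ[F] F) (H : Submodule F V) (u v : V) (w : H) :
    polarMap f H (exteriorPower.ιMulti F 2 ![u, v]) w = pairing (contraction f) u v w := by
  rw [polarMap, LinearMap.comp_apply, exteriorPower.alternatingMapLinearEquiv_apply_ιMulti]
  rfl

theorem pluecker_span_pair {u v : V} (huv : LinearIndependent F ![u, v]) :
    pluecker 1 (span F {u, v}) = span F {exteriorPower.ιMulti F 2 ![u, v]} := by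
  have := pluecker_span_range huv
  rwa [Matrix.range_cons_cons_empty] at this

theorem pluecker_le_ker_polarMap_iff (H : Submodule F V) {u v : V}
    (huv : LinearIndependent F ![u, v]) :
    pluecker 1 (span F {u, v}) ≤ LinearMap.ker (polarMap f H) ↔
      ∀ w ∈ H, pairing (contraction f) u v w = 0 := by
  rw [pluecker_span_pair huv, span_singleton_le_iff_mem, LinearMap.mem_ker]
  constructor
  · intro h w hw
    rw [← polarMap_ιMulti f H u v ⟨w, hw⟩, h, LinearMap.zero_apply]
  · intro h
    ext w
    rw [polarMap_ιMulti, h w w.2, LinearMap.zero_apply]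

theorem extPow_mono (k : ℕ) {X Y : Submodule F V} (h : X ≤ Y) : extPow k X ≤ extPow k Y := by
  have : X.subtype = Y.subtype ∘ₗ inclusion h := rfl
  rw [extPow, extPow, this, exteriorPower.map_comp]
  exact LinearMap.range_comp_le_range _ _

theorem IsComplexOf.pluecker_le_ker_iff (hK : IsComplexOf K f)
    (hsing : ∀ l, ¬ IsSingular 2 K l) (hV : 4 ≤ finrank F V)
    {H : Submodule F V} (hH : IsCoatom H) {l : Submodule F V} (hl : finrank F l = 2) :
    pluecker 1 l ≤ LinearMap.ker (polarMap f H) ↔ l ∈ polarLines K H := by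
  obtain ⟨u, v, huv, rfl⟩ := exists_linearIndependent_pair hl
  rw [pluecker_le_ker_polarMap_iff H huv]
  exact (hK.isPolarHyperplane_iff hsing hV hH huv).symm

theorem IsComplexOf.isLinearSpread_polarLines (hK : IsComplexOf K f)
    (hsing : ∀ l, ¬ IsSingular 2 K l) (hV : 4 ≤ finrank F V)
    {H : Submodule F V} (hH : IsCoatom H) : IsLinearSpread H (polarLines K H) := by
  have hS := hK.isLineSpread_polarLines hsing hV hH
  refine ⟨hS, LinearMap.ker (polarMap f H) ⊓ extPow 2 H, inf_le_right, ?_⟩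
  ext P
  constructor
  · rintro ⟨l, hl, rfl⟩
    have hlH := hS.1 hl
    exact ⟨⟨l, hlH, rfl⟩, le_inf ((hK.pluecker_le_ker_iff hsing hV hH hlH.1).2 hl)
      (extPow_mono 2 hlH.2)⟩
  · rintro ⟨⟨l, hl, rfl⟩, hle⟩
    exact ⟨l, (hK.pluecker_le_ker_iff hsing hV hH hl.1).1 (le_inf_iff.1 hle).1, rfl⟩

theorem IsComplexOf.image_pluecker_polarLines (hK : IsComplexOf K f)
    (hsing : ∀ l, ¬ IsSingular 2 K l) (hV : 4 ≤ finrank F V)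
    {H : Submodule F V} (hH : IsCoatom H) :
    pluecker 1 '' polarLines K H =
      grassmannLines (⊤ : Submodule F V) ∩ {P | P ≤ LinearMap.ker (polarMap f H)} := by
  ext P
  constructor
  · rintro ⟨l, hl, rfl⟩
    exact ⟨⟨l, ⟨hl.1, le_top⟩, rfl⟩, (hK.pluecker_le_ker_iff hsing hV hH hl.1).2 hl⟩
  · rintro ⟨⟨l, hl, rfl⟩, hle⟩
    exact ⟨l, (hK.pluecker_le_ker_iff hsing hV hH hl.1).1 hle, rfl⟩

/-- Functionals on H extend to V, and each functional on V kills some u ≠ 0, hence is of the form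
g(u,v). -/
theorem IsComplexOf.polarMap_surjective (hK : IsComplexOf K f)
    (hsing : ∀ l, ¬ IsSingular 2 K l) (hV : 2 ≤ finrank F V) (H : Submodule F V) :
    Function.Surjective (polarMap f H) := by
  have : FiniteDimensional F V := .of_finrank_pos (by omega)
  refine (LinearMap.dualMap_surjective_of_injective H.injective_subtype).comp fun θ => ?_
  obtain ⟨u, hu, hu0⟩ : ∃ u ∈ LinearMap.ker θ, u ≠ 0 := by
    refine exists_mem_ne_zero_of_ne_bot fun h => ?_
    have h1 := LinearMap.finrank_range_add_finrank_ker θ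
    have h2 := Submodule.finrank_le (LinearMap.range θ)
    rw [h, finrank_bot] at h1
    rw [finrank_self] at h2
    omega
  obtain ⟨v, hv⟩ := hK.exists_pairing_eq hsing hu0 hu
  refine ⟨exteriorPower.ιMulti F 2 ![u, v], ?_⟩
  rw [exteriorPower.alternatingMapLinearEquiv_apply_ιMulti, ← hv, pairing_apply]

theorem IsComplexOf.finrank_ker_polarMap (hK : IsComplexOf K f)
    (hsing : ∀ l, ¬ IsSingular 2 K l) (hV : 2 ≤ finrank F V) (H : Submodule F V) :
    finrank F H + finrank F (LinearMap.ker (polarMap f H)) = (finrank F V).choose 2 := by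
  have : FiniteDimensional F V := .of_finrank_pos (by omega)
  have h1 := LinearMap.finrank_range_add_finrank_ker (polarMap f H)
  rwa [LinearMap.range_eq_top.2 (hK.polarMap_surjective hsing hV H), finrank_top,
    Subspace.dual_finrank_eq, exteriorPower.finrank_eq] at h1

end Linear

/-! ### Geometric spreads force a singular line. -/

section Geometric

variable {F V : Type*} [Field F] [AddCommGroup V] [Module F V]
variable {K : Set (Submodule F V)} {f : V [⋀^Fin 3]→ₗ[F] F}

/-- The bivector with coordinates `x, A, D, -z, -w, y` is decomposable if it satisfies the
Plücker relation. -/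
theorem exists_factor_of_pluecker_relation {x y z w A D : F} (hzw : z ≠ 0 ∨ w ≠ 0)
    (h : x * y + A * w - D * z = 0) :
    ∃ p q r : F, z * p - x * q = A ∧ w * p - x * r = D ∧ w * q - z * r = y := by
  rcases hzw with hz | hw
  · refine ⟨A / z, 0, -y / z, by field_simp; ring, ?_, by field_simp; ring⟩
    field_simp
    linear_combination h
  · refine ⟨D / w, y / w, 0, ?_, by field_simp; ring, by field_simp; ring⟩
    field_simp
    linear_combination -h

/-- If the vectors `a, b, c, d` are independent, then suitable relations for the values of an
alternating bilinear map yield two independent vectors at which it vanishes. -/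
theorem exists_pairing_eq_zero {N : Type*} [AddCommGroup N] [Module F N]
    (hF : ∀ a b c d e : F, ∃ y z w : F, (y ≠ 0 ∨ z ≠ 0 ∨ w ≠ 0) ∧
      y ^ 2 + a * y * z + b * y * w + c * z ^ 2 + d * z * w + e * w ^ 2 = 0)
    (g : V [⋀^Fin 2]→ₗ[F] N) {a b c d : V}
    (hind : ∀ p q r s : F, p • a + q • b + r • c + s • d = 0 → p = 0 ∧ q = 0 ∧ r = 0 ∧ s = 0)
    {θ : N} (hab : pairing g a b = θ) (hcd : pairing g c d = θ) {γ δ μ γ' δ' μ' : F}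
    (hbc : γ • pairing g a c + δ • pairing g a d - pairing g b c = μ • θ)
    (hbd : γ' • pairing g a d - δ' • pairing g a c - pairing g b d = μ' • θ) :
    ∃ u v, LinearIndependent F ![u, v] ∧ pairing g u v = 0 := by
  -- The bivector with ab, ac, ad, bc, bd, cd coordinates x, A, D, -z, -w, y is killed by g if x, A,
  -- D are chosen as below. Substituting them into xy + Aw - Dz = 0 and changing the sign gives this
  -- form.
  obtain ⟨y, z, w, hne, h⟩ := hF μ μ' δ (γ' - γ) δ'
  have hzw : z ≠ 0 ∨ w ≠ 0 := by
    by_contra! hcon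
    obtain ⟨rfl, rfl⟩ := hcon
    have hy : y = 0 := by simpa using h
    exact hne.elim (fun h => h hy) (by simp)
  obtain ⟨p, q, r, h1, h2, h3⟩ := exists_factor_of_pluecker_relation
    (x := -(y + μ * z + μ' * w)) (y := y) (A := z * γ - w * δ') (D := z * δ + w * γ') hzw
    (by linear_combination -h)
  set x := -(y + μ * z + μ' * w) with hx
  refine ⟨-(x • a) - z • c - w • d, p • a + q • c + r • d - b, ?_, ?_⟩
  · refine LinearIndependent.pair_iff.2 fun s t hst => ?_
    obtain ⟨-, ht, hz, hw⟩ := hind (t * p - s * x) (-t) (t * q - s * z) (t * r - s * w)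
      (by rw [← hst]; module)
    have ht : t = 0 := by simpa using ht
    subst ht
    refine ⟨?_, rfl⟩
    rcases hzw with h0 | h0
    · simpa [h0] using hz
    · simpa [h0] using hw
  · simp only [map_add, map_sub, map_neg, map_smul, LinearMap.sub_apply,
      LinearMap.neg_apply, LinearMap.smul_apply, pairing_self]
    rw [pairing_swap g c a, pairing_swap g d a, pairing_swap g c b, pairing_swap g d b,
      pairing_swap g d c, hab, hcd]
    have h4 : (z * p - x * q) • pairing g a c + (w * p - x * r) • pairing g a d
        + (w * q - z * r) • θ + x • θ - z • pairing g b c - w • pairing g b d = 0 := by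
      rw [h1, h2, h3, hx]
      linear_combination (norm := module) z • hbc + w • hbd
    refine Eq.trans ?_ h4
    module

/-- The form on a basis of the line is a nonzero multiple of θ; rescaling the second vector
normalises it to θ. -/
theorem IsComplexOf.exists_pairing_eq_of_mem_polarLines (hK : IsComplexOf K f)
    (hsing : ∀ l, ¬ IsSingular 2 K l) (hV : 4 ≤ finrank F V) {θ : Dual F V}
    (hH : IsCoatom (LinearMap.ker θ)) {l : Submodule F V}
    (hl : l ∈ polarLines K (LinearMap.ker θ)) {u : V} (hu : u ≠ 0) (hul : u ∈ l) :
    ∃ v, LinearIndependent F ![u, v] ∧ l = span F {u, v} ∧ pairing (contraction f) u v = θ := by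
  obtain ⟨v, huv, rfl⟩ := exists_linearIndependent_pair_of_mem hl.1 hu hul
  have hv := (hK.isPolarHyperplane_iff hsing hV hH huv).1 hl
  obtain ⟨c, hc⟩ := exists_eq_smul_of_ker_le (θ := θ) hv
  have hc0 : c ≠ 0 := by
    rintro rfl
    exact hK.pairing_ne_zero hsing huv (by simpa using hc)
  have hi : LinearIndependent F ![u, c⁻¹ • v] := by
    refine LinearIndependent.pair_iff.2 fun s t hst => ?_
    have := LinearIndependent.pair_iff.1 huv s (t * c⁻¹) (by rw [← hst, mul_smul])
    simpa [hc0] using this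
  refine ⟨c⁻¹ • v, hi, eq_span_pair_of_mem hl.1 hi hul ?_, ?_⟩
  · exact smul_mem _ _ (subset_span (by simp))
  · rw [map_smul, hc, smul_smul, inv_mul_cancel₀ hc0, one_smul]

/-- In a geometric spread, the line through the point `a + c` of the solid spanned by the lines
`⟨a, b⟩` and `⟨c, d⟩` yields a relation between values of the alternating form. -/
theorem IsComplexOf.exists_relation_of_pairing_add (hK : IsComplexOf K f)
    (hsing : ∀ l, ¬ IsSingular 2 K l) {a b c d v : V} {θ : Dual F V} (ha : a ≠ 0)
    (hind : ∀ p q r s : F, p • a + q • b + r • c + s • d = 0 → p = 0 ∧ q = 0 ∧ r = 0 ∧ s = 0)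
    (hab : pairing (contraction f) a b = θ) (hcd : pairing (contraction f) c d = θ)
    (hv : v ∈ span F {a, b} ⊔ span F {c, d}) (hacv : pairing (contraction f) (a + c) v = θ) :
    ∃ γ δ μ : F, γ • pairing (contraction f) a c + δ • pairing (contraction f) a d -
      pairing (contraction f) b c = μ • θ := by
  obtain ⟨_, hx, _, hy, rfl⟩ := mem_sup.1 hv
  obtain ⟨α, β, rfl⟩ := mem_span_pair.1 hx
  obtain ⟨γ, δ, rfl⟩ := mem_span_pair.1 hy
  have key : (γ - α) • pairing (contraction f) a c + δ • pairing (contraction f) a d -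
      β • pairing (contraction f) b c = (1 - β - δ) • θ := by
    simp only [map_add, map_smul, LinearMap.add_apply, pairing_self] at hacv
    rw [pairing_swap _ c a, pairing_swap _ c b, hab, hcd] at hacv
    linear_combination (norm := module) hacv
  -- If β = 0, then (γ-α)c + δd - (1-δ)b lies in the kernel ⟨a⟩ of g(a,·), and independence forces
  -- both δ = 0 and 1 - δ = 0.
  have hβ : β ≠ 0 := by
    rintro rfl
    have hmem : (γ - α) • c + δ • d - (1 - δ) • b ∈ span F {a} := by
      rw [← hK.ker_pairing hsing ha, LinearMap.mem_ker]
      simp only [map_add, map_sub, map_smul, hab]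
      linear_combination (norm := module) key
    obtain ⟨p, hp⟩ := mem_span_singleton.1 hmem
    obtain ⟨-, h1, -, h2⟩ := hind (-p) (-(1 - δ)) (γ - α) δ (by rw [neg_smul, hp]; module)
    subst h2
    simp at h1
  refine ⟨β⁻¹ * (γ - α), β⁻¹ * δ, β⁻¹ * (1 - β - δ), ?_⟩
  have := congrArg (β⁻¹ • ·) key
  simpa only [smul_add, smul_sub, smul_smul, inv_mul_cancel₀ hβ, one_smul] using this

theorem IsLineSpread.eq_of_mem {W : Submodule F V} {S : Set (Submodule F V)}
    (hS : IsLineSpread W S) {l m : Submodule F V} (hl : l ∈ S) (hm : m ∈ S) {p : V} (hp : p ≠ 0)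
    (hpl : p ∈ l) (hpm : p ∈ m) : l = m := by
  have h := hS.2 (span F {p}) (finrank_span_singleton hp)
    ((span_singleton_le_iff_mem _ _).2 ((hS.1 hl).2 hpl))
  exact h.unique ⟨hl, (span_singleton_le_iff_mem _ _).2 hpl⟩
    ⟨hm, (span_singleton_le_iff_mem _ _).2 hpm⟩

theorem IsLineSpread.exists_mem {W : Submodule F V} {S : Set (Submodule F V)}
    (hS : IsLineSpread W S) {p : V} (hp : p ≠ 0) (hpW : p ∈ W) : ∃ l ∈ S, p ∈ l := by
  obtain ⟨l, ⟨hl, hpl⟩, -⟩ := hS.2 (span F {p}) (finrank_span_singleton hp)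
    ((span_singleton_le_iff_mem _ _).2 hpW)
  exact ⟨l, hl, (span_singleton_le_iff_mem _ _).1 hpl⟩

theorem IsComplexOf.not_isGeometricSpread_polarLines (hK : IsComplexOf K f)
    (hsing : ∀ l, ¬ IsSingular 2 K l) (hV : 4 ≤ finrank F V)
    (hF : ∀ a b c d e : F, ∃ y z w : F, (y ≠ 0 ∨ z ≠ 0 ∨ w ≠ 0) ∧
      y ^ 2 + a * y * z + b * y * w + c * z ^ 2 + d * z * w + e * w ^ 2 = 0)
    {H : Submodule F V} (hH : IsCoatom H) : ¬ IsGeometricSpread H (polarLines K H) := by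
  rintro ⟨hS, hgeo⟩
  have : FiniteDimensional F V := .of_finrank_pos (by omega)
  have hfr := finrank_isCoatom hH
  obtain ⟨θ, hθ, rfl⟩ := exists_ker_eq_of_isCoatom hH
  obtain ⟨a, haH, ha⟩ : ∃ a ∈ LinearMap.ker θ, a ≠ 0 := by
    refine exists_mem_ne_zero_of_ne_bot fun h => ?_
    rw [h, finrank_bot] at hfr
    omega
  obtain ⟨l, hl, hal⟩ := hS.exists_mem ha haH
  obtain ⟨b, hiab, rfl, hab⟩ := hK.exists_pairing_eq_of_mem_polarLines hsing hV hH hl ha hal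
  obtain ⟨c, hcH, hcl⟩ := exists_mem_notMem_span_pair (F := F) (u := a) (v := b)
    (X := LinearMap.ker θ) (by omega)
  have hc : c ≠ 0 := fun h => hcl (h ▸ zero_mem _)
  obtain ⟨m, hm, hcm⟩ := hS.exists_mem hc hcH
  obtain ⟨d, hicd, rfl, hcd⟩ := hK.exists_pairing_eq_of_mem_polarLines hsing hV hH hm hc hcm
  have hne : span F {a, b} ≠ span F {c, d} := fun h => hcl (h ▸ hcm)
  have hind (p q r s : F) (h : p • a + q • b + r • c + s • d = 0) :
      p = 0 ∧ q = 0 ∧ r = 0 ∧ s = 0 := by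
    have h0 : p • a + q • b = 0 := by
      by_contra hx
      refine hne (hS.eq_of_mem hl hm hx (mem_span_pair.2 ⟨p, q, rfl⟩)
        (mem_span_pair.2 ⟨-r, -s, ?_⟩))
      linear_combination (norm := module) -h
    obtain ⟨hp, hq⟩ := LinearIndependent.pair_iff.1 hiab p q h0
    obtain ⟨hr, hs⟩ := LinearIndependent.pair_iff.1 hicd r s (by
      linear_combination (norm := module) h - h0)
    exact ⟨hp, hq, hr, hs⟩
  have hline (x y : V) (hxy : span F {c, d} = span F {x, y}) (hx : a + x ≠ 0) :
      ∃ v ∈ span F {a, b} ⊔ span F {x, y}, pairing (contraction f) (a + x) v = θ := by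
    rw [← hxy]
    have hmem : a + x ∈ span F {a, b} ⊔ span F {c, d} := by
      refine add_mem (le_sup_left (α := Submodule F V) hal) (le_sup_right (α := Submodule F V) ?_)
      rw [hxy]
      exact subset_span (by simp)
    obtain ⟨k, ⟨hk, hkT⟩, hak⟩ := (hgeo _ hl _ hm hne).exists_mem hx hmem
    obtain ⟨v, -, rfl, hv⟩ := hK.exists_pairing_eq_of_mem_polarLines hsing hV hH hk hx hak
    exact ⟨v, hkT (subset_span (by simp)), hv⟩
  obtain ⟨v, hvT, hv⟩ := hline c d rfl fun h => by
    simpa using hind 1 0 1 0 (by linear_combination (norm := module) h)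
  obtain ⟨γ, δ, μ, h1⟩ := hK.exists_relation_of_pairing_add hsing ha hind hab hcd hvT hv
  -- The basis (d, -c) also has value θ, so the relation obtained from a + c applies to a + d as
  -- well.
  have hdc : span F {c, d} = span F {d, -c} := by
    refine eq_span_pair_of_mem hm.1 ?_ (subset_span (by simp)) (neg_mem (subset_span (by simp)))
    refine LinearIndependent.pair_iff.2 fun s t hst => ?_
    have := LinearIndependent.pair_iff.1 hicd (-t) s (by
      linear_combination (norm := module) hst)
    simpa using this.symm
  obtain ⟨v', hvT', hv'⟩ := hline d (-c) hdc fun h => by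
    simpa using hind 1 0 0 1 (by linear_combination (norm := module) h)
  have hind' (p q r s : F) (h : p • a + q • b + r • d + s • (-c) = 0) :
      p = 0 ∧ q = 0 ∧ r = 0 ∧ s = 0 := by
    have := hind p q (-s) r (by linear_combination (norm := module) h)
    simpa [and_comm] using this
  have hdc' : pairing (contraction f) d (-c) = θ := by
    rw [map_neg, ← pairing_swap, hcd]
  obtain ⟨γ', δ', μ', h2⟩ := hK.exists_relation_of_pairing_add hsing ha hind' hab hdc' hvT' hv'
  rw [map_neg, smul_neg, ← sub_eq_add_neg] at h2
  obtain ⟨x, y, hxy, h0⟩ := exists_pairing_eq_zero hF (contraction f) hind hab hcd h1 h2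
  exact hK.pairing_ne_zero hsing hxy h0

end Geometric

theorem propositionp {F V : Type*} [Field F] [AddCommGroup V] [Module F V]
    (n : ℕ) (hn : 3 ≤ n) (hV : finrank F V = n + 1)
    (K : Set (Submodule F V)) (hK : IsLinearComplex 2 K)
    (hsing : ∀ l : Submodule F V, ¬ IsSingular 2 K l)
    (H : Submodule F V) (hH : IsCoatom H) :
    IsLinearSpread H (polarLines K H) ∧
    (∃ R : Submodule F (⋀[F]^2 V),
      IsProjSubspace ((n ^ 2 + n - 2) / 2 - n) R ∧
      pluecker 1 '' polarLines K H = grassmannLines (⊤ : Submodule F V) ∩ {P | P ≤ R}) ∧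
    (IsQuadraticallyClosed F → ¬ IsGeometricSpread H (polarLines K H)) ∧
    (Finite F → ¬ IsGeometricSpread H (polarLines K H)) := by
  obtain ⟨f, hf⟩ := hK.exists_alternatingMap
  have h4 : 4 ≤ finrank F V := by omega
  have : FiniteDimensional F V := .of_finrank_pos (by omega)
  refine ⟨hf.isLinearSpread_polarLines hsing h4 hH,
    ⟨_, ?_, hf.image_pluecker_polarLines hsing h4 hH⟩,
    fun hF => hf.not_isGeometricSpread_polarLines hsing h4
      (exists_isotropic_of_isQuadraticallyClosed hF) hH,
    fun hF => hf.not_isGeometricSpread_polarLines hsing h4 exists_isotropic_of_finite hH⟩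
  have h1 := hf.finrank_ker_polarMap hsing (by omega) H
  have h2 := finrank_isCoatom hH
  have h3 : (n + 1).choose 2 * 2 = n ^ 2 + n := by
    rw [Nat.choose_two_right, Nat.div_mul_cancel (Nat.even_mul_pred_self _).two_dvd]
    simp only [Nat.add_sub_cancel]
    ring
  -- Guarantees that the truncated subtractions in the projective dimension are genuine.
  have h5 : 3 * n ≤ n ^ 2 := by nlinarith
  rw [hV] at h1 h2
  rw [IsProjSubspace]
  omega
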